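/- Let $a<b$ be real numbers and $I:=(a,b)$. Let $D_I\varphi:=\varphi'$ be the derivative operator in $L^2_{\mathbb C}(I)$ with domain $C_0^\infty(I,\mathbb C)$, $D_I^*$ its adjoint, $\partial:=-D_I^*$ the weak derivative, $W^1_{\mathbb C}(I):=D(\partial)$ (with norm $(\|u\|_2^2+\|\partial u\|_2^2)^{1/2}$), and $W^1_{0,\mathbb C}(I)$ the closure of $C_0^\infty(I,\mathbb C)$ in $W^1_{\mathbb C}(I)$. Let $\mathcal L$ be the set of all real-valued $\bar p\in L^\infty(I)$ for which there are $C_2\ge C_1>0$ with $C_1\le\bar p\le C_2$ a.e. on $I$, and let $\mathcal P$ be the set of all real-valued $\bar p\in L^\infty(I)\setminus\{0\}$ with $\bar p\ge 0$ a.e. on $I$. For $\bar p\in\mathcal L$ put $p:=1/\bar p$ and let $A_{\bar p}u:=D_I^*\,(1/\bar p)\,\partial u$ with domain $D(A_{\bar p}):=\{u\in W^1_{0,\mathbb C}(I): (1/\bar p)\,\partial u\in D(D_I^*)\}$. For every $\bar p\in\mathcal P$ there are bounded linear operators $B_{\bar p}$, $C_{\bar p}$ on $L^2_{\mathbb C}(I)$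 such that, for all $f\in L^2_{\mathbb C}(I)$ and almost every $x\in I$, $$(B_{\bar p}f)(x)=-\int_a^x\Big[\int_y^x\bar p(u)\,du\Big]f(y)\,dy+\|\bar p\|_1^{-1}\int_a^x\bar p(y)\,dy\,\int_a^b\Big[\int_y^b\bar p(u)\,du\Big]f(y)\,dy,$$ $$(C_{\bar p}f)(x)=-\int_a^x f(y)\,dy+\|\bar p\|_1^{-1}\int_a^b\Big[\int_y^b\bar p(u)\,du\Big]f(y)\,dy,$$ and the following hold. (i) Let $\bar p_\infty\in\mathcal P$ and let $\bar p_1,\bar p_2,\dots$ be a sequence in $\mathcal L$ with $\lim_{\nu\to\infty}\|\bar p_\nu-\bar p_\infty\|_1=0$. Put $A_\nu:=A_{\bar p_\nu}$ and $p_\nu:=1/\bar p_\nu$. Then every $A_\nu:D(A_\nu)\to L^2_{\mathbb C}(I)$ is bijective, $A_\nu^{-1}$ and $-p_\nu D_I^*A_\nu^{-1}$ are bounded linear operators defined on all of $L^2_{\mathbb C}(I)$, and in the operator norm $$\lim_{\nu\to\infty}A_\nu^{-1}=B_{\bar p_\infty},\qquad \lim_{\nu\to\infty}\big(-p_\nu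 D_I^*A_\nu^{-1}\big)=C_{\bar p_\infty}.$$ (ii) The map $\bar p\mapsto B_{\bar p}$ is the unique extension of $\mathcal L\ni\bar p\mapsto A_{\bar p}^{-1}$ to a map on $\mathcal P$ with values in the bounded operators on $L^2_{\mathbb C}(I)$ that is sequentially continuous from the $L^1$ norm to the operator norm, and $\bar p\mapsto C_{\bar p}$ is the unique such extension of $\mathcal L\ni\bar p\mapsto-(1/\bar p)D_I^*A_{\bar p}^{-1}$. -/

import Mathlib

open MeasureTheory Filter Topology Set
open scoped ENNReal InnerProductSpace Distributions

namespace Diffusion1D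

noncomputable section

/-- Lebesgue measure on the open interval `I = (a, b)`. -/
abbrev intervalMeasure (a b : ℝ) : Measure ℝ := volume.restrict (Ioo a b)

/-- The complex Hilbert space `L²_ℂ(I)`. -/
abbrev L2 (a b : ℝ) : Type := Lp ℂ 2 (intervalMeasure a b)

/-- The space `L^∞(I)` of real-valued functions. -/
abbrev LInf (a b : ℝ) : Type := Lp ℝ ∞ (intervalMeasure a b)

/-- The interval `I = (a, b)` as a bundled open set. -/
def openInterval (a b : ℝ) : TopologicalSpace.Opens ℝ := ⟨Ioo a b, isOpen_Ioo⟩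

/-! ### The derivative on test functions, its adjoint, and Sobolev spaces -/

theorem memLp_testFunction {a b : ℝ} (φ : 𝓓(openInterval a b, ℂ)) :
    MemLp (φ : ℝ → ℂ) 2 (intervalMeasure a b) :=
  φ.continuous.memLp_of_hasCompactSupport φ.hasCompactSupport

theorem memLp_deriv_testFunction {a b : ℝ} (φ : 𝓓(openInterval a b, ℂ)) :
    MemLp (deriv (φ : ℝ → ℂ)) 2 (intervalMeasure a b) :=
  (φ.contDiff.continuous_deriv (by simp)).memLp_of_hasCompactSupport φ.hasCompactSupport.deriv

theorem differentiable_testFunction {a b : ℝ} (φ : 𝓓(openInterval a b, ℂ)) :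
    Differentiable ℝ (φ : ℝ → ℂ) :=
  φ.contDiff.differentiable (by simp)

/-- The inclusion of `C_0^∞(I, ℂ)` into `L²_ℂ(I)`. -/
def testToL2 (a b : ℝ) : 𝓓(openInterval a b, ℂ) →ₗ[ℂ] L2 a b where
  toFun φ := (memLp_testFunction φ).toLp φ
  map_add' φ ψ := MemLp.toLp_add (memLp_testFunction φ) (memLp_testFunction ψ)
  map_smul' c φ := MemLp.toLp_const_smul c (memLp_testFunction φ)

/-- `φ ↦ φ'` as a map from `C_0^∞(I, ℂ)` to `L²_ℂ(I)`. -/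
def testDerivToL2 (a b : ℝ) : 𝓓(openInterval a b, ℂ) →ₗ[ℂ] L2 a b where
  toFun φ := (memLp_deriv_testFunction φ).toLp (deriv (φ : ℝ → ℂ))
  map_add' φ ψ := by
    rw [← MemLp.toLp_add]
    congr 1
    funext x
    exact deriv_add (differentiable_testFunction φ x) (differentiable_testFunction ψ x)
  map_smul' c φ := by
    rw [RingHom.id_apply, ← MemLp.toLp_const_smul]
    congr 1
    funext x
    exact deriv_const_smul c (differentiable_testFunction φ x)

theorem testToL2_injective (a b : ℝ) : Function.Injective (testToL2 a b) := by
  intro φ ψ h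
  have h' : (φ : ℝ → ℂ) =ᵐ[intervalMeasure a b] ψ :=
    (MemLp.toLp_eq_toLp_iff (memLp_testFunction φ) (memLp_testFunction ψ)).1 h
  have h2 : EqOn (φ : ℝ → ℂ) ψ (Ioo a b) :=
    Measure.eqOn_open_of_ae_eq h' isOpen_Ioo φ.continuous.continuousOn ψ.continuous.continuousOn
  ext x
  by_cases hx : x ∈ Ioo a b
  · exact h2 hx
  · rw [image_eq_zero_of_notMem_tsupport (fun hm => hx (φ.tsupport_subset hm)),
      image_eq_zero_of_notMem_tsupport (fun hm => hx (ψ.tsupport_subset hm))]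

/-- The operator `D_I` in `L²_ℂ(I)`, with domain `C_0^∞(I, ℂ)`, `D_I φ = φ'`. -/
def derivOp (a b : ℝ) : L2 a b →ₗ.[ℂ] L2 a b where
  domain := LinearMap.range (testToL2 a b)
  toFun := testDerivToL2 a b ∘ₗ
    (LinearEquiv.ofInjective (testToL2 a b) (testToL2_injective a b)).symm.toLinearMap

/-- The adjoint `D_I^*` (in the sense of unbounded operators; `D_I` is densely defined). -/
def derivAdj (a b : ℝ) : L2 a b →ₗ.[ℂ] L2 a b := LinearPMap.adjoint (derivOp a b)

/-- The weak derivative `∂ = -D_I^*`. Its domain is the Sobolev space `W¹_ℂ(I)`. -/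
def weakDeriv (a b : ℝ) : L2 a b →ₗ.[ℂ] L2 a b := -derivAdj a b

/-- `W¹_{0,ℂ}(I)`, the closure of `C_0^∞(I, ℂ)` in `W¹_ℂ(I)`: the elements `u` of `W¹_ℂ(I)` that are
limits of a sequence of test functions in the Sobolev norm `(‖u‖² + ‖∂u‖²)^{1/2}`. -/
def sobolevZero (a b : ℝ) : Submodule ℂ (L2 a b) where
  carrier := {u | ∃ (v : (weakDeriv a b).domain) (φ : ℕ → (weakDeriv a b).domain),
    (v : L2 a b) = u ∧ (∀ n, (φ n : L2 a b) ∈ LinearMap.range (testToL2 a b)) ∧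
    Tendsto (fun n => (φ n : L2 a b)) atTop (𝓝 (v : L2 a b)) ∧
    Tendsto (fun n => weakDeriv a b (φ n)) atTop (𝓝 (weakDeriv a b v))}
  zero_mem' := ⟨0, fun _ => 0, rfl, fun _ => Submodule.zero_mem _, tendsto_const_nhds,
    tendsto_const_nhds⟩
  add_mem' := by
    rintro _ _ ⟨v, φ, rfl, h1, h2, h3⟩ ⟨w, ψ, rfl, k1, k2, k3⟩
    refine ⟨v + w, fun n => φ n + ψ n, rfl, fun n => Submodule.add_mem _ (h1 n) (k1 n),
      h2.add k2, ?_⟩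
    simpa only [LinearPMap.map_add] using h3.add k3
  smul_mem' := by
    rintro c _ ⟨v, φ, rfl, h1, h2, h3⟩
    refine ⟨c • v, fun n => c • φ n, rfl, fun n => Submodule.smul_mem _ c (h1 n),
      h2.const_smul c, ?_⟩
    simpa only [LinearPMap.map_smul] using h3.const_smul c

/-! ### Operators in `L²_ℂ(I)` -/

/-- The composition `S ∘ T` of two partially defined operators, on its natural domain
`{u ∈ D(T) : T u ∈ D(S)}`. -/
def pcomp {E : Type*} [AddCommGroup E] [Module ℂ E] (S T : E →ₗ.[ℂ] E) : E →ₗ.[ℂ] E where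
  domain := (S.domain.comap T.toFun).map T.domain.subtype
  toFun :=
    { toFun := fun u => S ⟨T ⟨u, by obtain ⟨w, -, h⟩ := u.2; exact h ▸ w.2⟩,
        by obtain ⟨_, ⟨w, hw, rfl⟩⟩ := u; exact hw⟩
      map_add' := fun u v => by
        rw [← S.map_add]
        congr 1
        exact Subtype.ext (T.map_add ⟨u, _⟩ ⟨v, _⟩)
      map_smul' := fun c u => by
        rw [RingHom.id_apply, ← S.map_smul]
        congr 1
        exact Subtype.ext (T.map_smul c ⟨u, _⟩) }

/-- The maximal operator of multiplication by a real function `m` in `L²_ℂ(I)`. -/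
def mulOp (a b : ℝ) (m : ℝ → ℝ) : L2 a b →ₗ.[ℂ] L2 a b where
  domain :=
    { carrier := {v | MemLp (fun x => (m x : ℂ) * v x) 2 (intervalMeasure a b)}
      zero_mem' := by
        refine (MemLp.zero' (ε := ℂ)).ae_eq ?_
        filter_upwards [Lp.coeFn_zero ℂ 2 (intervalMeasure a b)] with x hx
        rw [hx]
        simp
      add_mem' := by
        intro v w hv hw
        refine (hv.add hw).ae_eq ?_
        filter_upwards [Lp.coeFn_add v w] with x hx
        rw [hx]
        exact (mul_add _ _ _).symm
      smul_mem' := by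
        intro c v hv
        refine (hv.const_smul c).ae_eq ?_
        filter_upwards [Lp.coeFn_smul c v] with x hx
        rw [hx]
        exact mul_left_comm c _ _ }
  toFun :=
    { toFun := fun v => MemLp.toLp _ v.2
      map_add' := by
        intro v w
        rw [← MemLp.toLp_add, MemLp.toLp_eq_toLp_iff]
        filter_upwards [Lp.coeFn_add (v : L2 a b) w] with x hx
        change (m x : ℂ) * ((v : L2 a b) + (w : L2 a b) : L2 a b) x = _
        rw [hx]
        exact mul_add _ _ _
      map_smul' := by
        intro c v
        rw [RingHom.id_apply, ← MemLp.toLp_const_smul, MemLp.toLp_eq_toLp_iff]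
        filter_upwards [Lp.coeFn_smul c (v : L2 a b)] with x hx
        change (m x : ℂ) * (c • (v : L2 a b) : L2 a b) x = _
        rw [hx]
        exact mul_left_comm _ c _ }

/-- The diffusion operator `A = D_I^* (1/p̄) ∂` with domain
`{u ∈ W¹_{0,ℂ}(I) : (1/p̄) ∂u ∈ D(D_I^*)}`. The diffusivity is `p = 1/p̄`. -/
def diffusionOp (a b : ℝ) (pbar : LInf a b) : L2 a b →ₗ.[ℂ] L2 a b :=
  pcomp (derivAdj a b)
    (pcomp (mulOp a b fun x => (pbar x)⁻¹) ((weakDeriv a b).domRestrict (sobolevZero a b)))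

/-- The inverse `A⁻¹` of the diffusion operator, as a partially defined operator. -/
def solutionOp (a b : ℝ) (pbar : LInf a b) : L2 a b →ₗ.[ℂ] L2 a b :=
  (diffusionOp a b pbar).inverse

/-- The operator `-p D_I^* A⁻¹`, where `p = 1/p̄`. -/
def fluxOp (a b : ℝ) (pbar : LInf a b) : L2 a b →ₗ.[ℂ] L2 a b :=
  -pcomp (mulOp a b fun x => (pbar x)⁻¹) (pcomp (derivAdj a b) (solutionOp a b pbar))

/-- `T` is defined on the whole of `L²_ℂ(I)` and equals the bounded linear operator `R`. -/
def EqBounded {a b : ℝ} (T : L2 a b →ₗ.[ℂ] L2 a b) (R : L2 a b →L[ℂ] L2 a b) : Prop :=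
  T = (R : L2 a b →ₗ[ℂ] L2 a b).toPMap ⊤

/-! ### Classes of coefficients -/

/-- The class `𝓛` of the `p̄ ∈ L^∞(I)` with `C₁ ≤ p̄ ≤ C₂` a.e. for some `C₂ ≥ C₁ > 0`. -/
def regularClass (a b : ℝ) : Set (LInf a b) :=
  {pbar | ∃ C₁ C₂ : ℝ, 0 < C₁ ∧ C₁ ≤ C₂ ∧ ∀ᵐ x ∂intervalMeasure a b, C₁ ≤ pbar x ∧ pbar x ≤ C₂}

/-- The a.e. positive (that is, `≥ 0`) elements of `L^∞(I) \ {0}`; the diffusivity `1/p̄` is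
infinite where `p̄` vanishes. -/
def asymptoticClass (a b : ℝ) : Set (LInf a b) :=
  {pbar | (∀ᵐ x ∂intervalMeasure a b, 0 ≤ pbar x) ∧ pbar ≠ 0}

/-- The `L¹(I)` norm. -/
def norm1 (a b : ℝ) (g : LInf a b) : ℝ := ∫ x in a..b, |g x|

/-- `B f`, pointwise. -/
def limitSolution (a b : ℝ) (pbar : LInf a b) (f : L2 a b) (x : ℝ) : ℂ :=
  -(∫ y in a..x, ((∫ u in y..x, pbar u : ℝ) : ℂ) * f y) +
    (((norm1 a b pbar)⁻¹ * ∫ y in a..x, pbar y : ℝ) : ℂ) *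
      ∫ y in a..b, ((∫ u in y..b, pbar u : ℝ) : ℂ) * f y

/-- `C f`, pointwise. -/
def limitFlux (a b : ℝ) (pbar : LInf a b) (f : L2 a b) (x : ℝ) : ℂ :=
  -(∫ y in a..x, f y) +
    (((norm1 a b pbar)⁻¹ : ℝ) : ℂ) * ∫ y in a..b, ((∫ u in y..b, pbar u : ℝ) : ℂ) * f y

/-- `Φ` is an extension of the operator-valued map `p̄ ↦ T p̄`, `p̄ ∈ 𝓛`, to the asymptotic
class, and it is sequentially continuous from the `L¹` norm to the operator norm. -/
def IsSeqContExtension {a b : ℝ} (T : LInf a b → (L2 a b →ₗ.[ℂ] L2 a b))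
    (Φ : asymptoticClass a b → (L2 a b →L[ℂ] L2 a b)) : Prop :=
  (∀ p : asymptoticClass a b, (p : LInf a b) ∈ regularClass a b → EqBounded (T p) (Φ p)) ∧
  ∀ (q : ℕ → asymptoticClass a b) (p : asymptoticClass a b),
    Tendsto (fun ν => norm1 a b ((q ν : LInf a b) - p)) atTop (𝓝 0) →
      Tendsto (fun ν => Φ (q ν)) atTop (𝓝 (Φ p))

end

end Diffusion1D

open Diffusion1D

/-! In one dimension the equation `A u = f` is solved by integrating twice, and the resulting
formulas involve `p̄` but never `1/p̄`.

Let `V` be integration from `a`. The lemma of du Bois-Reymond shows that `D_I^* w = f` holds exactly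
when `w = c - V f` for some constant `c` (`mem_graph_derivAdj_iff_exists`). Approximation by test
functions shows that `u` lies in `W¹₀` with `∂u = h` exactly when `u = V h` and `h` has mean zero
(`mem_graph_domRestrict_sobolevZero_iff`). For `p̄` in `𝓛`, `A u = f` therefore means `u = V h` with
`h = p̄ (c - V f)` of mean zero. The mean condition forces `c = ‖p̄‖₁⁻¹ ∫ p̄ V f` (`fluxConst`).
This gives one solution for every `f`, namely `u = V (p̄ (c - V f))` (`solOp`), and the flux is `-p
D_I^* u = p ∂u = c - V f` (`flxOp`). Fubini's theorem on a triangle turns both into the stated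
kernels.

Both formulas make sense for every `p̄` in `𝓟`. They are built from `f ↦ p̄ V f`, which is linear in
`p̄` and, as a map from `L²` to `L¹`, has norm at most a constant times `‖p̄‖₁`; since `V` maps `L¹`
boundedly into `L²`, convergence of coefficients in `L¹` gives convergence in operator norm
(`tendsto_solOp`, `tendsto_flxOp`). The factor `‖p̄‖₁⁻¹` is harmless because the limit coefficient
is nonzero. Uniqueness holds because `p̄ + ε` lies in `𝓛` and tends to `p̄` in `L¹`
(`exists_regular_approx`). -/

namespace Diffusion1D

noncomputable section

/-! ### Primitives of integrable functions on `(a, b)` -/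

/-- The primitive of `g` that vanishes at `a`. -/
def prim (a : ℝ) (g : ℝ → ℂ) (x : ℝ) : ℂ := ∫ y in a..x, g y

theorem restrict_Icc_eq (a b : ℝ) : (volume.restrict (Icc a b) : Measure ℝ) = intervalMeasure a b :=
  Measure.restrict_congr_set Ioo_ae_eq_Icc.symm

theorem restrict_Ioc_eq (a b : ℝ) : (volume.restrict (Ioc a b) : Measure ℝ) = intervalMeasure a b :=
  Measure.restrict_congr_set Ioo_ae_eq_Ioc.symm

theorem ae_mem_Icc (a b : ℝ) : ∀ᵐ x ∂intervalMeasure a b, x ∈ Icc a b := by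
  filter_upwards [ae_restrict_mem (measurableSet_Ioo (a := a) (b := b))] with x hx
  exact Ioo_subset_Icc_self hx

section Primitive

variable {a b : ℝ} {E : Type*} [NormedAddCommGroup E]

theorem integrableOn_Icc {g : ℝ → E} (hg : Integrable g (intervalMeasure a b)) :
    IntegrableOn g (Icc a b) volume := by
  rwa [IntegrableOn, restrict_Icc_eq]

theorem intervalIntegrable_of_integrable {g : ℝ → E} (hg : Integrable g (intervalMeasure a b))
    {x y : ℝ} (hx : x ∈ Icc a b) (hy : y ∈ Icc a b) : IntervalIntegrable g volume x y :=
  ((integrableOn_Icc hg).mono_set (uIcc_subset_Icc hx hy)).intervalIntegrable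

theorem intervalIntegral_eq [NormedSpace ℝ E] (hab : a ≤ b) (g : ℝ → E) :
    ∫ x in a..b, g x = ∫ x, g x ∂intervalMeasure a b := by
  rw [intervalIntegral.integral_of_le hab, restrict_Ioc_eq]

theorem continuousOn_prim {g : ℝ → ℂ} (hg : Integrable g (intervalMeasure a b)) :
    ContinuousOn (prim a g) (Icc a b) := by
  rcases le_or_gt a b with hab | hab
  · have := intervalIntegral.continuousOn_primitive_interval (f := g) (μ := volume) (a := a)
      (b := b) (by rw [uIcc_of_le hab]; exact integrableOn_Icc hg)
    rwa [uIcc_of_le hab] at this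
  · simp [Icc_eq_empty_of_lt hab]

theorem aestronglyMeasurable_prim {g : ℝ → ℂ} (hg : Integrable g (intervalMeasure a b)) :
    AEStronglyMeasurable (prim a g) (intervalMeasure a b) := by
  rw [← restrict_Icc_eq]
  exact (continuousOn_prim hg).aestronglyMeasurable measurableSet_Icc

/-- This bound of a primitive in the sup norm by the `L¹` norm underlies every operator estimate
below. -/
theorem norm_prim_le {g : ℝ → ℂ} (hg : Integrable g (intervalMeasure a b)) {x : ℝ}
    (hx : x ∈ Icc a b) : ‖prim a g x‖ ≤ ∫ y, ‖g y‖ ∂intervalMeasure a b := by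
  refine (intervalIntegral.norm_integral_le_integral_norm hx.1).trans ?_
  rw [intervalIntegral.integral_of_le hx.1, ← restrict_Ioc_eq]
  refine setIntegral_mono_set ?_ (ae_of_all _ fun _ => norm_nonneg _)
    (Ioc_subset_Ioc_right hx.2).eventuallyLE
  exact ((integrableOn_Icc hg).mono_set Ioc_subset_Icc_self).norm

theorem memLp_prim {g : ℝ → ℂ} (hg : Integrable g (intervalMeasure a b)) (p : ℝ≥0∞) :
    MemLp (prim a g) p (intervalMeasure a b) := by
  refine MemLp.of_bound (aestronglyMeasurable_prim hg) (∫ y, ‖g y‖ ∂intervalMeasure a b) ?_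
  filter_upwards [ae_mem_Icc a b] with x hx using norm_prim_le hg hx

theorem integrable_mul_prim {f g : ℝ → ℂ} (hf : Integrable f (intervalMeasure a b))
    (hg : Integrable g (intervalMeasure a b)) :
    Integrable (fun x => f x * prim a g x) (intervalMeasure a b) := by
  refine hf.mul_bdd (c := ∫ y, ‖g y‖ ∂intervalMeasure a b) (aestronglyMeasurable_prim hg) ?_
  filter_upwards [ae_mem_Icc a b] with x hx using norm_prim_le hg hx

theorem prim_add {f g : ℝ → ℂ} (hf : Integrable f (intervalMeasure a b))
    (hg : Integrable g (intervalMeasure a b)) {x : ℝ} (hx : x ∈ Icc a b) :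
    prim a (fun y => f y + g y) x = prim a f x + prim a g x :=
  intervalIntegral.integral_add
    (intervalIntegrable_of_integrable hf ⟨le_rfl, hx.1.trans hx.2⟩ hx)
    (intervalIntegrable_of_integrable hg ⟨le_rfl, hx.1.trans hx.2⟩ hx)

theorem prim_const_mul (c : ℂ) (f : ℝ → ℂ) (x : ℝ) :
    prim a (fun y => c * f y) x = c * prim a f x :=
  intervalIntegral.integral_const_mul c f

theorem prim_congr {f g : ℝ → ℂ} (h : f =ᵐ[intervalMeasure a b] g) {x : ℝ} (hx : x ∈ Icc a b) :
    prim a f x = prim a g x := by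
  refine intervalIntegral.integral_congr_ae ?_
  rw [uIoc_of_le hx.1, ← ae_restrict_iff' measurableSet_Ioc]
  rw [← restrict_Ioc_eq] at h
  exact ae_restrict_of_ae_restrict_of_subset (Ioc_subset_Ioc_right hx.2) h

/-- Fubini's theorem on a triangle. -/
theorem integral_mul_prim {f g : ℝ → ℂ} (hf : Integrable f (intervalMeasure a b))
    (hg : Integrable g (intervalMeasure a b)) {x : ℝ} (hx : x ∈ Icc a b) :
    ∫ t in a..x, f t * prim a g t = ∫ y in a..x, (∫ t in y..x, f t) * g y := by
  have hμ : volume.restrict (Ioc a x) ≤ intervalMeasure a b := by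
    rw [← restrict_Ioc_eq]; exact Measure.restrict_mono (Ioc_subset_Ioc_right hx.2) le_rfl
  have hf' := hf.mono_measure hμ
  have hg' := hg.mono_measure hμ
  set μ : Measure ℝ := volume.restrict (Ioc a x)
  have hint : Integrable (Function.uncurry fun t y : ℝ =>
      {q : ℝ × ℝ | q.2 ≤ q.1}.indicator (fun q => f q.1 * g q.2) (t, y)) (μ.prod μ) :=
    (hf'.mul_prod hg').indicator (measurableSet_le measurable_snd measurable_fst)
  have key := integral_integral_swap hint
  rw [intervalIntegral.integral_of_le hx.1, intervalIntegral.integral_of_le hx.1]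
  refine Eq.trans ?_ (key.trans ?_)
  · refine setIntegral_congr_fun measurableSet_Ioc fun t ht => ?_
    have : (fun y => {q : ℝ × ℝ | q.2 ≤ q.1}.indicator (fun q => f q.1 * g q.2) (t, y)) =
        (Iic t).indicator fun y => f t * g y := by
      ext y; simp [indicator]
    simp only [this]
    rw [integral_indicator measurableSet_Iic, integral_const_mul, prim,
      intervalIntegral.integral_of_le ht.1.le, Measure.restrict_restrict measurableSet_Iic]
    congr 3
    ext y
    simp only [mem_inter_iff, mem_Ioc, mem_Iic]
    exact ⟨fun h => ⟨h.2, h.1, h.2.trans ht.2⟩, fun h => ⟨h.2.1, h.1⟩⟩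
  · refine setIntegral_congr_fun measurableSet_Ioc fun y hy => ?_
    have : (fun t => {q : ℝ × ℝ | q.2 ≤ q.1}.indicator (fun q => f q.1 * g q.2) (t, y)) =
        (Ici y).indicator fun t => f t * g y := by
      ext t; simp [indicator]
    simp only [this]
    -- The section of the triangle at `y` is the closed interval `[y, x]`, hence the passage from
    -- `Ioc` to `Icc`.
    rw [integral_indicator measurableSet_Ici, integral_mul_const,
      intervalIntegral.integral_of_le hy.2, Measure.restrict_restrict measurableSet_Ici,
      ← integral_Icc_eq_integral_Ioc]
    congr 3
    ext t
    simp only [mem_inter_iff, mem_Ioc, mem_Ici, mem_Icc]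
    exact ⟨fun h => ⟨h.1, h.2.2⟩, fun h => ⟨h.1, hy.1.trans_le h.1, h.2⟩⟩

end Primitive

/-! ### The bounded operators from which `B` and `C` are built -/

section Operators

variable (a b : ℝ)

/-- The complex space `L¹(I)`. -/
abbrev L1C : Type := Lp ℂ 1 (intervalMeasure a b)

variable {a b}

theorem integrable_L1 (f : L1C a b) : Integrable f (intervalMeasure a b) :=
  memLp_one_iff_integrable.1 (Lp.memLp f)

theorem integrable_L2 (f : L2 a b) : Integrable f (intervalMeasure a b) :=
  (Lp.memLp f).integrable (by norm_num)

theorem integrable_coeff (p : LInf a b) :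
    Integrable (fun x => (p x : ℂ)) (intervalMeasure a b) :=
  ((Lp.memLp p).integrable le_top).ofReal

variable (a b)

/-- `g ↦ ∫_a^x g` as a bounded operator from `L¹` to `L²`. -/
def primOp : L1C a b →L[ℂ] L2 a b :=
  LinearMap.mkContinuous
    { toFun := fun g => (memLp_prim (integrable_L1 g) 2).toLp
      map_add' := fun f g => by
        rw [← MemLp.toLp_add, MemLp.toLp_eq_toLp_iff]
        filter_upwards [ae_mem_Icc a b] with x hx
        rw [prim_congr (Lp.coeFn_add f g) hx]
        exact prim_add (integrable_L1 f) (integrable_L1 g) hx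
      map_smul' := fun c f => by
        rw [RingHom.id_apply, ← MemLp.toLp_const_smul, MemLp.toLp_eq_toLp_iff]
        filter_upwards [ae_mem_Icc a b] with x hx
        rw [prim_congr (Lp.coeFn_smul c f) hx]
        exact prim_const_mul c f x }
    -- The constant is the square root of the length of `I`, the cost of passing from a sup bound to
    -- the `L²` norm.
    ((measureUnivNNReal (intervalMeasure a b) : ℝ) ^ (2 : ℝ≥0∞).toReal⁻¹) (fun g => by
      rw [L1.norm_eq_integral_norm]
      refine Lp.norm_le_of_ae_bound (integral_nonneg fun _ => norm_nonneg _) ?_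
      filter_upwards [ae_mem_Icc a b, MemLp.coeFn_toLp (memLp_prim (integrable_L1 g) 2)]
        with x hx h
      simpa only [LinearMap.coe_mk, AddHom.coe_mk, h] using norm_prim_le (integrable_L1 g) hx)

/-- The integral as a complex-linear functional on `L¹`. -/
def integralOp : L1C a b →L[ℂ] ℂ :=
  LinearMap.mkContinuous
    { toFun := fun g => ∫ x, g x ∂intervalMeasure a b
      map_add' := fun f g => by
        rw [integral_congr_ae (Lp.coeFn_add f g)]
        exact integral_add (integrable_L1 f) (integrable_L1 g)
      map_smul' := fun c f => by
        rw [integral_congr_ae (Lp.coeFn_smul c f)]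
        exact integral_const_mul c f }
    1 (fun g => by
      rw [one_mul, L1.norm_eq_integral_norm]
      exact norm_integral_le_integral_norm _)

/-- The inclusion of `L²(I)` into `L¹(I)`. -/
def inclL1 : L2 a b →L[ℂ] L1C a b :=
  LinearMap.mkContinuous
    { toFun := fun f => (integrable_L2 f).toL1
      map_add' := fun f g => by
        rw [← Integrable.toL1_add, Integrable.toL1_eq_toL1_iff]
        exact Lp.coeFn_add f g
      map_smul' := fun c f => by
        rw [RingHom.id_apply, ← Integrable.toL1_smul, Integrable.toL1_eq_toL1_iff]
        exact Lp.coeFn_smul c f }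
    -- Hölder's constant; the exponent is `1 - 1/2`.
    (((intervalMeasure a b) univ ^ (1 / (1 : ℝ≥0∞).toReal - 1 / (2 : ℝ≥0∞).toReal)).toReal)
    (fun f => by
      have h := eLpNorm_le_eLpNorm_mul_rpow_measure_univ (μ := intervalMeasure a b) (p := 1)
        (q := 2) one_le_two (Lp.aestronglyMeasurable f)
      have hfin : (intervalMeasure a b) univ ^
          (1 / (1 : ℝ≥0∞).toReal - 1 / (2 : ℝ≥0∞).toReal) ≠ ∞ :=
        ENNReal.rpow_ne_top_of_nonneg (by norm_num) (measure_ne_top _ _)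
      have h2 := ENNReal.toReal_mono (ENNReal.mul_ne_top (Lp.eLpNorm_ne_top f) hfin) h
      rw [ENNReal.toReal_mul, mul_comm, ← Lp.norm_def] at h2
      refine le_trans (le_of_eq ?_) h2
      rw [Lp.norm_def]
      exact congrArg _ (eLpNorm_congr_ae (Integrable.coeFn_toL1 (integrable_L2 f))))

variable {a b}

theorem inclL1_coeFn (f : L2 a b) : inclL1 a b f =ᵐ[intervalMeasure a b] f :=
  Integrable.coeFn_toL1 (integrable_L2 f)

theorem primOp_coeFn (g : L1C a b) : primOp a b g =ᵐ[intervalMeasure a b] prim a g :=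
  MemLp.coeFn_toLp (memLp_prim (integrable_L1 g) 2)

theorem integral_norm_le (f : L2 a b) :
    ∫ x, ‖f x‖ ∂intervalMeasure a b ≤ ‖inclL1 a b‖ * ‖f‖ := by
  rw [← L1.norm_of_fun_eq_integral_norm (integrable_L2 f)]
  exact (inclL1 a b).le_opNorm f

variable (a b)

/-- The Volterra operator `(V f)(x) = ∫_a^x f` on `L²(I)`. -/
def volterra : L2 a b →L[ℂ] L2 a b := primOp a b ∘L inclL1 a b

/-- The constant function `1`. -/
def oneL2 : L2 a b := (memLp_const (1 : ℂ)).toLp (fun _ : ℝ => (1 : ℂ))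

variable {a b}

theorem oneL2_coeFn : ∀ᵐ x ∂intervalMeasure a b, oneL2 a b x = 1 :=
  MemLp.coeFn_toLp (memLp_const (1 : ℂ))

theorem volterra_coeFn (f : L2 a b) : volterra a b f =ᵐ[intervalMeasure a b] prim a f := by
  filter_upwards [primOp_coeFn (inclL1 a b f), ae_mem_Icc a b] with x h hx
  rw [← prim_congr (inclL1_coeFn f) hx, ← h]
  rfl

/-- An element of `L^∞(I)` as an element of the complex space `L¹(I)`. -/
def coeffL1 (p : LInf a b) : L1C a b := (integrable_coeff p).toL1

theorem coeffL1_coeFn (p : LInf a b) :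
    ∀ᵐ x ∂intervalMeasure a b, coeffL1 p x = (p x : ℂ) :=
  Integrable.coeFn_toL1 (integrable_coeff p)

theorem coeffL1_sub (p q : LInf a b) : coeffL1 (p - q) = coeffL1 p - coeffL1 q := by
  rw [coeffL1, coeffL1, coeffL1, ← Integrable.toL1_sub, Integrable.toL1_eq_toL1_iff]
  filter_upwards [Lp.coeFn_sub p q] with x hx
  exact (congrArg _ hx).trans (Complex.ofReal_sub _ _)

theorem integral_norm_coeff (hab : a < b) (p : LInf a b) :
    ∫ x, ‖(p x : ℂ)‖ ∂intervalMeasure a b = norm1 a b p := by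
  rw [norm1, intervalIntegral_eq hab.le]
  simp

theorem norm_coeffL1 (hab : a < b) (p : LInf a b) : ‖coeffL1 p‖ = norm1 a b p := by
  rw [coeffL1, L1.norm_of_fun_eq_integral_norm, integral_norm_coeff hab]

/-- The operator `f ↦ p ∫_a^x f` from `L²` to `L¹`. -/
def mulPrimOp (p : LInf a b) : L2 a b →L[ℂ] L1C a b :=
  LinearMap.mkContinuous
    { toFun := fun f => (integrable_mul_prim (integrable_coeff p) (integrable_L2 f)).toL1
      map_add' := fun f g => by
        rw [← Integrable.toL1_add, Integrable.toL1_eq_toL1_iff]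
        filter_upwards [ae_mem_Icc a b] with x hx
        rw [prim_congr (Lp.coeFn_add f g) hx]
        exact (congrArg _ (prim_add (integrable_L2 f) (integrable_L2 g) hx)).trans (mul_add _ _ _)
      map_smul' := fun c f => by
        rw [RingHom.id_apply, ← Integrable.toL1_smul, Integrable.toL1_eq_toL1_iff]
        filter_upwards [ae_mem_Icc a b] with x hx
        rw [prim_congr (Lp.coeFn_smul c f) hx]
        exact (congrArg _ (prim_const_mul c f x)).trans (mul_left_comm _ _ _) }
    ((∫ x, ‖(p x : ℂ)‖ ∂intervalMeasure a b) * ‖inclL1 a b‖) (fun f => by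
      refine (L1.norm_of_fun_eq_integral_norm
        (integrable_mul_prim (integrable_coeff p) (integrable_L2 f))).trans_le ?_
      rw [mul_assoc, ← integral_mul_const]
      refine integral_mono_ae
        (integrable_mul_prim (integrable_coeff p) (integrable_L2 f)).norm
        ((integrable_coeff p).norm.mul_const _) ?_
      filter_upwards [ae_mem_Icc a b] with x hx
      rw [norm_mul]
      exact mul_le_mul_of_nonneg_left
        ((norm_prim_le (integrable_L2 f) hx).trans (integral_norm_le f)) (norm_nonneg _))

theorem mulPrimOp_coeFn (p : LInf a b) (f : L2 a b) :
    ∀ᵐ x ∂intervalMeasure a b, mulPrimOp p f x = (p x : ℂ) * prim a f x :=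
  Integrable.coeFn_toL1 (integrable_mul_prim (integrable_coeff p) (integrable_L2 f))

theorem mulPrimOp_sub (p q : LInf a b) : mulPrimOp (p - q) = mulPrimOp p - mulPrimOp q := by
  ext1 f
  refine Lp.ext ?_
  filter_upwards [mulPrimOp_coeFn p f, mulPrimOp_coeFn q f, mulPrimOp_coeFn (p - q) f,
    Lp.coeFn_sub p q, Lp.coeFn_sub (mulPrimOp p f) (mulPrimOp q f)] with x h1 h2 h3 h4 h5
  rw [_root_.sub_apply, h5, h3, Pi.sub_apply, h1, h2, h4]
  simp [sub_mul]

/-- Only the `L¹` norm of the coefficient enters, because `∫_a^x f` is bounded uniformly in `x`.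
Together with `mulPrimOp_sub` this makes the dependence on the coefficient Lipschitz from `L¹` to
the operator norm. -/
theorem norm_mulPrimOp_le (hab : a < b) (p : LInf a b) :
    ‖mulPrimOp p‖ ≤ norm1 a b p * ‖inclL1 a b‖ := by
  rw [← integral_norm_coeff hab]
  exact LinearMap.mkContinuous_norm_le _
    (mul_nonneg (integral_nonneg fun _ => norm_nonneg _) (norm_nonneg _)) _

/-- The functional `f ↦ ‖p‖₁⁻¹ ∫_a^b p(t) ∫_a^t f(y) dy dt`. -/
def fluxConst (p : LInf a b) : L2 a b →L[ℂ] ℂ :=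
  ((norm1 a b p)⁻¹ : ℂ) • (integralOp a b ∘L mulPrimOp p)

/-- The operator `B`. -/
def solOp (p : LInf a b) : L2 a b →L[ℂ] L2 a b :=
  -(primOp a b ∘L mulPrimOp p) + (fluxConst p).smulRight (primOp a b (coeffL1 p))

/-- The operator `C`. -/
def flxOp (p : LInf a b) : L2 a b →L[ℂ] L2 a b :=
  -volterra a b + (fluxConst p).smulRight (oneL2 a b)

theorem fluxConst_apply (p : LInf a b) (f : L2 a b) :
    fluxConst p f =
      ((norm1 a b p)⁻¹ : ℂ) * ∫ x, (p x : ℂ) * prim a f x ∂intervalMeasure a b :=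
  congrArg (((norm1 a b p)⁻¹ : ℂ) * ·) (integral_congr_ae (mulPrimOp_coeFn p f))

theorem flxOp_coeFn (p : LInf a b) (f : L2 a b) :
    ∀ᵐ x ∂intervalMeasure a b, flxOp p f x = -prim a f x + fluxConst p f := by
  filter_upwards [Lp.coeFn_add (-volterra a b f) (fluxConst p f • oneL2 a b),
    Lp.coeFn_neg (volterra a b f), Lp.coeFn_smul (fluxConst p f) (oneL2 a b),
    volterra_coeFn f, oneL2_coeFn] with x h1 h2 h3 h4 h5
  refine h1.trans ?_
  rw [Pi.add_apply, h2, h3, Pi.neg_apply, Pi.smul_apply, h4, h5, smul_eq_mul, mul_one]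

theorem solOp_coeFn (p : LInf a b) (f : L2 a b) :
    ∀ᵐ x ∂intervalMeasure a b, solOp p f x =
      -prim a (fun t => (p t : ℂ) * prim a f t) x + fluxConst p f * prim a (fun t => (p t : ℂ)) x := by
  filter_upwards [Lp.coeFn_add (-primOp a b (mulPrimOp p f))
      (fluxConst p f • primOp a b (coeffL1 p)),
    Lp.coeFn_neg (primOp a b (mulPrimOp p f)), Lp.coeFn_smul (fluxConst p f)
      (primOp a b (coeffL1 p)),
    primOp_coeFn (mulPrimOp p f), primOp_coeFn (coeffL1 p), ae_mem_Icc a b]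
    with x h1 h2 h3 h4 h5 hx
  refine h1.trans ?_
  rw [Pi.add_apply, h2, h3, Pi.neg_apply, Pi.smul_apply, h4, h5, smul_eq_mul,
    prim_congr (mulPrimOp_coeFn p f) hx, prim_congr (coeffL1_coeFn p) hx]

theorem ofReal_intervalIntegral (p : LInf a b) (x y : ℝ) :
    ((∫ u in x..y, p u : ℝ) : ℂ) = ∫ u in x..y, (p u : ℂ) :=
  intervalIntegral.integral_ofReal.symm

theorem fluxConst_eq (hab : a < b) (p : LInf a b) (f : L2 a b) :
    fluxConst p f = (((norm1 a b p)⁻¹ : ℝ) : ℂ) *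
      ∫ y in a..b, ((∫ u in y..b, p u : ℝ) : ℂ) * f y := by
  simp only [ofReal_intervalIntegral]
  rw [fluxConst_apply, ← intervalIntegral_eq hab.le,
    integral_mul_prim (integrable_coeff p) (integrable_L2 f) ⟨hab.le, le_rfl⟩, Complex.ofReal_inv]

theorem flxOp_eq_limitFlux (hab : a < b) (p : LInf a b) (f : L2 a b) :
    ∀ᵐ x ∂intervalMeasure a b, flxOp p f x = limitFlux a b p f x := by
  filter_upwards [flxOp_coeFn p f] with x hx
  rw [hx, fluxConst_eq hab, limitFlux, prim]

/-- Fubini on the triangle over `(a, x)` converts the iterated primitive into the kernel `∫_y^x p`;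
the constant `fluxConst` is the same computation at `x = b`. -/
theorem solOp_eq_limitSolution (hab : a < b) (p : LInf a b) (f : L2 a b) :
    ∀ᵐ x ∂intervalMeasure a b, solOp p f x = limitSolution a b p f x := by
  filter_upwards [solOp_coeFn p f, ae_mem_Icc a b] with x hx hxI
  rw [hx, fluxConst_eq hab, limitSolution, prim, prim,
    integral_mul_prim (integrable_coeff p) (integrable_L2 f) hxI]
  simp only [ofReal_intervalIntegral, Complex.ofReal_mul]
  ring

/-! ### Continuity in the coefficient -/

section Convergence

variable {ι : Type*} {l : Filter ι} {q : ι → LInf a b} {p : LInf a b}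

theorem tendsto_coeffL1 (hab : a < b) (h : Tendsto (fun i => norm1 a b (q i - p)) l (𝓝 0)) :
    Tendsto (fun i => coeffL1 (q i)) l (𝓝 (coeffL1 p)) := by
  rw [tendsto_iff_norm_sub_tendsto_zero]
  simpa only [← coeffL1_sub, norm_coeffL1 hab] using h

theorem tendsto_norm1 (hab : a < b) (h : Tendsto (fun i => norm1 a b (q i - p)) l (𝓝 0)) :
    Tendsto (fun i => norm1 a b (q i)) l (𝓝 (norm1 a b p)) := by
  simpa only [norm_coeffL1 hab] using (tendsto_coeffL1 hab h).norm

theorem tendsto_mulPrimOp (hab : a < b) (h : Tendsto (fun i => norm1 a b (q i - p)) l (𝓝 0)) :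
    Tendsto (fun i => mulPrimOp (q i)) l (𝓝 (mulPrimOp p)) := by
  rw [tendsto_iff_norm_sub_tendsto_zero]
  have h' := h.mul_const ‖inclL1 a b‖
  rw [zero_mul] at h'
  refine squeeze_zero (fun _ => norm_nonneg _) (fun i => ?_) h'
  rw [← mulPrimOp_sub]
  exact norm_mulPrimOp_le hab _

theorem norm1_pos (hab : a < b) (hp : p ≠ 0) : 0 < norm1 a b p := by
  rw [← norm_coeffL1 hab, norm_pos_iff]
  intro h
  apply hp
  refine Lp.ext ?_
  filter_upwards [coeffL1_coeFn p, Lp.coeFn_zero ℝ ∞ (intervalMeasure a b),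
    Lp.coeFn_zero ℂ 1 (intervalMeasure a b)] with x h1 h2 h3
  rw [h, h3] at h1
  rw [h2]
  exact Complex.ofReal_eq_zero.1 h1.symm

theorem tendsto_const_comp {F G : Type*} [NormedAddCommGroup F] [NormedSpace ℂ F]
    [NormedAddCommGroup G] [NormedSpace ℂ G] (T : F →L[ℂ] G) {S : ι → L2 a b →L[ℂ] F}
    {S₀ : L2 a b →L[ℂ] F} (h : Tendsto S l (𝓝 S₀)) :
    Tendsto (fun i => T ∘L S i) l (𝓝 (T ∘L S₀)) :=
  ((continuous_const.clm_comp continuous_id).tendsto S₀).comp h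

/-- Inversion of the `L¹` norm is continuous at `p` because `p ≠ 0`; this is where the exclusion of
`0` from `𝓟` is needed. -/
theorem tendsto_fluxConst (hab : a < b) (hp : p ≠ 0)
    (h : Tendsto (fun i => norm1 a b (q i - p)) l (𝓝 0)) :
    Tendsto (fun i => fluxConst (q i)) l (𝓝 (fluxConst p)) := by
  have h1 : Tendsto (fun i => ((norm1 a b (q i) : ℂ))⁻¹) l (𝓝 ((norm1 a b p : ℂ))⁻¹) :=
    ((Complex.continuous_ofReal.tendsto _).comp (tendsto_norm1 hab h)).inv₀
      (by exact_mod_cast (norm1_pos hab hp).ne')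
  exact h1.smul (tendsto_const_comp _ (tendsto_mulPrimOp hab h))

theorem tendsto_smulRight {φ : ι → L2 a b →L[ℂ] ℂ} {ψ : L2 a b →L[ℂ] ℂ} {v : ι → L2 a b}
    {w : L2 a b} (hφ : Tendsto φ l (𝓝 ψ)) (hv : Tendsto v l (𝓝 w)) :
    Tendsto (fun i => (φ i).smulRight (v i)) l (𝓝 (ψ.smulRight w)) :=
  (isBoundedBilinearMap_apply.continuous.tendsto
    (ContinuousLinearMap.smulRightL ℂ (L2 a b) (L2 a b) ψ, w)).comp
    ((((ContinuousLinearMap.smulRightL ℂ (L2 a b) (L2 a b)).continuous.tendsto ψ).comp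
      hφ).prodMk_nhds hv)

theorem tendsto_solOp (hab : a < b) (hp : p ≠ 0)
    (h : Tendsto (fun i => norm1 a b (q i - p)) l (𝓝 0)) :
    Tendsto (fun i => solOp (q i)) l (𝓝 (solOp p)) :=
  (tendsto_const_comp _ (tendsto_mulPrimOp hab h)).neg.add
    (tendsto_smulRight (tendsto_fluxConst hab hp h)
      (((primOp a b).continuous.tendsto _).comp (tendsto_coeffL1 hab h)))

theorem tendsto_flxOp (hab : a < b) (hp : p ≠ 0)
    (h : Tendsto (fun i => norm1 a b (q i - p)) l (𝓝 0)) :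
    Tendsto (fun i => flxOp (q i)) l (𝓝 (flxOp p)) :=
  tendsto_const_nhds.add (tendsto_smulRight (tendsto_fluxConst hab hp h) tendsto_const_nhds)

end Convergence

end Operators

/-! ### The adjoint of the derivative and Sobolev spaces -/

section Sobolev

variable {a b : ℝ}

theorem inner_L2_eq (f g : L2 a b) :
    ⟪f, g⟫_ℂ = ∫ x, g x * starRingEnd ℂ (f x) ∂intervalMeasure a b := rfl

theorem testToL2_coeFn (φ : 𝓓(openInterval a b, ℂ)) :
    testToL2 a b φ =ᵐ[intervalMeasure a b] φ :=
  MemLp.coeFn_toLp (memLp_testFunction φ)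

theorem testDerivToL2_coeFn (φ : 𝓓(openInterval a b, ℂ)) :
    testDerivToL2 a b φ =ᵐ[intervalMeasure a b] deriv φ :=
  MemLp.coeFn_toLp (memLp_deriv_testFunction φ)

theorem testFunction_eq_zero (φ : 𝓓(openInterval a b, ℂ)) {x : ℝ} (hx : x ∉ Ioo a b) : φ x = 0 :=
  image_eq_zero_of_notMem_tsupport fun hm => hx (φ.tsupport_subset hm)

theorem integral_deriv_testFunction (φ : 𝓓(openInterval a b, ℂ)) (x y : ℝ) :
    ∫ t in x..y, deriv φ t = φ y - φ x :=
  intervalIntegral.integral_deriv_eq_sub (fun t _ => differentiable_testFunction φ t)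
    ((φ.contDiff.continuous_deriv (by simp)).intervalIntegrable x y)

theorem integrable_conj {f : ℝ → ℂ} (hf : Integrable f (intervalMeasure a b)) :
    Integrable (fun x => starRingEnd ℂ (f x)) (intervalMeasure a b) :=
  (Complex.conjCLE : ℂ →L[ℝ] ℂ).integrable_comp hf

theorem prim_conj (f : ℝ → ℂ) (x : ℝ) :
    prim a (fun y => starRingEnd ℂ (f y)) x = starRingEnd ℂ (prim a f x) := by
  simp only [prim, intervalIntegral, map_sub, integral_conj]

theorem volterra_testDeriv (φ : 𝓓(openInterval a b, ℂ)) :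
    volterra a b (testDerivToL2 a b φ) = testToL2 a b φ := by
  refine Lp.ext ?_
  filter_upwards [volterra_coeFn (testDerivToL2 a b φ), testToL2_coeFn φ, ae_mem_Icc a b]
    with x h1 h2 hx
  rw [h1, h2, prim_congr (testDerivToL2_coeFn φ) hx, prim, integral_deriv_testFunction,
    testFunction_eq_zero φ (x := a) (by simp), sub_zero]

theorem inner_oneL2 (hab : a < b) (f : L2 a b) : ⟪oneL2 a b, f⟫_ℂ = prim a f b := by
  rw [inner_L2_eq, prim, intervalIntegral_eq hab.le]
  refine integral_congr_ae ?_
  filter_upwards [oneL2_coeFn] with x hx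
  rw [hx, map_one, mul_one]

theorem inner_one_testDeriv (hab : a < b) (φ : 𝓓(openInterval a b, ℂ)) :
    ⟪oneL2 a b, testDerivToL2 a b φ⟫_ℂ = 0 := by
  rw [inner_oneL2 hab, prim_congr (testDerivToL2_coeFn φ) ⟨hab.le, le_rfl⟩, prim,
    integral_deriv_testFunction, testFunction_eq_zero φ (by simp),
    testFunction_eq_zero φ (by simp), sub_zero]

/-- Integration by parts against a test function. -/
theorem inner_volterra_testDeriv (hab : a < b) (h : L2 a b) (φ : 𝓓(openInterval a b, ℂ)) :
    ⟪volterra a b h, testDerivToL2 a b φ⟫_ℂ = -⟪h, testToL2 a b φ⟫_ℂ := by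
  have hφ : Integrable (deriv φ) (intervalMeasure a b) :=
    (memLp_deriv_testFunction φ).integrable (by norm_num)
  have key := integral_mul_prim hφ (integrable_conj (integrable_L2 h)) (x := b) ⟨hab.le, le_rfl⟩
  rw [intervalIntegral_eq hab.le, intervalIntegral_eq hab.le] at key
  rw [inner_L2_eq, inner_L2_eq, ← integral_neg]
  refine Eq.trans ?_ (key.trans ?_) <;> refine integral_congr_ae ?_
  · filter_upwards [volterra_coeFn h, testDerivToL2_coeFn φ] with x h1 h2
    rw [h1, h2, prim_conj]
  · filter_upwards [testToL2_coeFn φ] with x h1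
    rw [h1, integral_deriv_testFunction, testFunction_eq_zero φ (x := b) (by simp), zero_sub,
      neg_mul]

/-- An element orthogonal to all test functions vanishes a.e. by the fundamental lemma of the
calculus of variations, for which real-valued test functions suffice. -/
theorem dense_testToL2 : Dense (LinearMap.range (testToL2 a b) : Set (L2 a b)) := by
  rw [Submodule.dense_iff_topologicalClosure_eq_top, Submodule.topologicalClosure_eq_top_iff,
    Submodule.eq_bot_iff]
  intro f hf
  have hae : ∀ᵐ x ∂intervalMeasure a b, x ∈ Ioo a b → f x = 0 := by
    refine isOpen_Ioo.ae_eq_zero_of_integral_contDiff_smul_eq_zero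
      ((integrable_L2 f).locallyIntegrable.locallyIntegrableOn _) fun g hg hgc hgs => ?_
    have hsupp : Function.support (fun x => (g x : ℂ)) = Function.support g := by
      ext x; simp
    have hts : tsupport (fun x => (g x : ℂ)) = tsupport g := by rw [tsupport, hsupp, tsupport]
    let φ : 𝓓(openInterval a b, ℂ) :=
      ⟨fun x => (g x : ℂ), Complex.ofRealCLM.contDiff.comp hg, by
        rw [HasCompactSupport, hts]; exact hgc, by rw [hts]; exact hgs⟩
    have h0 := (Submodule.mem_orthogonal _ _).1 hf (testToL2 a b φ) ⟨φ, rfl⟩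
    rw [inner_L2_eq] at h0
    rw [← h0]
    refine integral_congr_ae ?_
    filter_upwards [testToL2_coeFn φ] with x hx
    have : φ x = (g x : ℂ) := rfl
    rw [hx, this, Complex.conj_ofReal, mul_comm, Complex.real_smul]
  refine Lp.ext ?_
  filter_upwards [hae, ae_restrict_mem (measurableSet_Ioo (a := a) (b := b)),
    Lp.coeFn_zero ℂ 2 (intervalMeasure a b)] with x h1 h2 h3
  rw [h1 h2, h3]
  rfl

/-- A test function of mean zero is the derivative of a test function. -/
theorem exists_deriv_eq (hab : a < b) (ψ : 𝓓(openInterval a b, ℂ)) (h0 : ∫ x in a..b, ψ x = 0) :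
    ∃ φ : 𝓓(openInterval a b, ℂ), testDerivToL2 a b φ = testToL2 a b ψ := by
  -- The midpoint is added so that `K` is nonempty even for `ψ = 0`; its infimum and supremum then
  -- lie in `(a, b)`.
  have hK : IsCompact (insert ((a + b) / 2) (tsupport ψ)) := ψ.hasCompactSupport.isCompact.insert _
  have hKs : insert ((a + b) / 2) (tsupport ψ) ⊆ Ioo a b :=
    insert_subset ⟨by linarith, by linarith⟩ ψ.tsupport_subset
  set K := insert ((a + b) / 2) (tsupport ψ)
  have hne : K.Nonempty := insert_nonempty _ _
  have hc := hKs (hK.sInf_mem hne)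
  have hd := hKs (hK.sSup_mem hne)
  have hz : ∀ x, x ∉ Icc (sInf K) (sSup K) → ψ x = 0 := fun x hx =>
    image_eq_zero_of_notMem_tsupport fun hm => hx
      ⟨csInf_le hK.bddBelow (mem_insert_of_mem _ hm), le_csSup hK.bddAbove (mem_insert_of_mem _ hm)⟩
  set F : ℝ → ℂ := fun x => ∫ t in a..x, ψ t
  have hderiv : deriv F = ψ := funext fun x => ψ.continuous.deriv_integral _ a x
  have hdiff : Differentiable ℝ F := fun x =>
    (ψ.continuous.integral_hasStrictDerivAt a x).hasDerivAt.differentiableAt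
  -- To the left of `K` the integrand vanishes; to the right, the integral is already the full mean,
  -- which is zero.
  have hFz : ∀ x, x ∉ Icc (sInf K) (sSup K) → F x = 0 := by
    intro x hx
    rcases lt_or_ge x (sInf K) with hlt | hge
    · refine (intervalIntegral.integral_congr (g := fun _ => (0 : ℂ)) fun t ht => ?_).trans
        (by simp)
      exact hz t fun h => absurd (h.1.trans ht.2) (not_le.2 (max_lt hc.1 hlt))
    · have hgt : sSup K < x := lt_of_not_ge fun h => hx ⟨hge, h⟩
      have hadd : F x + ∫ t in x..b, ψ t = ∫ t in a..b, ψ t :=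
        intervalIntegral.integral_add_adjacent_intervals
        (ψ.continuous.intervalIntegrable a x) (ψ.continuous.intervalIntegrable x b)
      have : ∫ t in x..b, ψ t = 0 := by
        refine (intervalIntegral.integral_congr (g := fun _ => (0 : ℂ)) fun t ht => ?_).trans
          (by simp)
        exact hz t fun h => absurd (ht.1.trans h.2) (not_le.2 (lt_min hgt hd.2))
      rwa [this, add_zero, h0] at hadd
  have hts : tsupport F ⊆ Icc (sInf K) (sSup K) :=
    closure_minimal (fun x hx => by_contra fun h => hx (hFz x h)) isClosed_Icc
  let φ : 𝓓(openInterval a b, ℂ) :=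
    ⟨F, contDiff_infty_iff_deriv.2 ⟨hdiff, by rw [hderiv]; exact ψ.contDiff⟩,
      isCompact_Icc.of_isClosed_subset (isClosed_tsupport _) hts,
      hts.trans (Icc_subset_Ioo hc.1 hd.2)⟩
  refine ⟨φ, Lp.ext ?_⟩
  filter_upwards [testDerivToL2_coeFn φ, testToL2_coeFn ψ] with x h1 h2
  rw [h1, h2]
  exact congrFun hderiv x

theorem exists_deriv_eq' (hab : a < b) (ψ : 𝓓(openInterval a b, ℂ))
    (h0 : ⟪oneL2 a b, testToL2 a b ψ⟫_ℂ = 0) :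
    ∃ φ : 𝓓(openInterval a b, ℂ), testDerivToL2 a b φ = testToL2 a b ψ := by
  refine exists_deriv_eq hab ψ ?_
  rwa [inner_oneL2 hab, prim_congr (testToL2_coeFn ψ) ⟨hab.le, le_rfl⟩] at h0

/-- Otherwise, after rescaling, the constant `1` would be orthogonal to the dense set of test
functions and hence zero. -/
theorem exists_test_mean_one (hab : a < b) :
    ∃ ψ : 𝓓(openInterval a b, ℂ), ⟪oneL2 a b, testToL2 a b ψ⟫_ℂ = 1 := by
  by_contra! hne
  have hzero : ∀ ψ : 𝓓(openInterval a b, ℂ), ⟪oneL2 a b, testToL2 a b ψ⟫_ℂ = 0 := by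
    intro ψ
    by_contra h
    refine hne ((⟪oneL2 a b, testToL2 a b ψ⟫_ℂ)⁻¹ • ψ) ?_
    rw [map_smul, inner_smul_right, inv_mul_cancel₀ h]
  have h1 : oneL2 a b = 0 := by
    refine dense_testToL2.eq_zero_of_inner_left ℂ ?_
    rintro _ ⟨ψ, rfl⟩
    exact hzero ψ
  have h2 : ⟪oneL2 a b, oneL2 a b⟫_ℂ = 0 := by rw [h1, inner_zero_left]
  rw [inner_oneL2 hab, prim_congr (g := fun _ => 1) oneL2_coeFn ⟨hab.le, le_rfl⟩, prim] at h2
  simp [sub_eq_zero, hab.ne'] at h2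

/-- Every test function is, up to a multiple of a fixed one, a derivative. -/
theorem exists_deriv_eq_sub (hab : a < b) {ψ₀ : 𝓓(openInterval a b, ℂ)}
    (h₀ : ⟪oneL2 a b, testToL2 a b ψ₀⟫_ℂ = 1) (ψ : 𝓓(openInterval a b, ℂ)) :
    ∃ φ : 𝓓(openInterval a b, ℂ), testDerivToL2 a b φ =
      testToL2 a b ψ - ⟪oneL2 a b, testToL2 a b ψ⟫_ℂ • testToL2 a b ψ₀ := by
  obtain ⟨φ, hφ⟩ := exists_deriv_eq' hab (ψ - ⟪oneL2 a b, testToL2 a b ψ⟫_ℂ • ψ₀) (by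
    rw [map_sub, map_smul, inner_sub_right, inner_smul_right, h₀, mul_one, sub_self])
  exact ⟨φ, by rw [hφ, map_sub, map_smul]⟩

/-- The lemma of du Bois-Reymond. -/
theorem eq_smul_one_of_inner_testDeriv_eq_zero (hab : a < b) {w : L2 a b}
    (hw : ∀ φ : 𝓓(openInterval a b, ℂ), ⟪w, testDerivToL2 a b φ⟫_ℂ = 0) :
    ∃ c : ℂ, w = c • oneL2 a b := by
  obtain ⟨ψ₀, h₀⟩ := exists_test_mean_one hab
  -- Testing against `ψ₀` forces this constant; the conjugate appears because the inner product is
  -- conjugate-linear in its first argument.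
  refine ⟨starRingEnd ℂ ⟪w, testToL2 a b ψ₀⟫_ℂ, ?_⟩
  refine dense_testToL2.eq_of_inner_left ℂ ?_
  rintro _ ⟨ψ, rfl⟩
  obtain ⟨φ, hφ⟩ := exists_deriv_eq_sub hab h₀ ψ
  have := hw φ
  rw [hφ, inner_sub_right, inner_smul_right, sub_eq_zero] at this
  rw [inner_smul_left, this, Complex.conj_conj, mul_comm]

theorem derivOp_apply (φ : 𝓓(openInterval a b, ℂ)) :
    derivOp a b ⟨testToL2 a b φ, ⟨φ, rfl⟩⟩ = testDerivToL2 a b φ := by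
  change testDerivToL2 a b ((LinearEquiv.ofInjective (testToL2 a b)
    (testToL2_injective a b)).symm ⟨testToL2 a b φ, ⟨φ, rfl⟩⟩) = _
  congr 1
  rw [LinearEquiv.symm_apply_eq]
  rfl

/-- Unbounded operators are handled through their graphs, so that domain conditions need no separate
treatment. Density of the test functions makes the adjoint single-valued. -/
theorem mem_graph_derivAdj_iff {u g : L2 a b} :
    (u, g) ∈ (derivAdj a b).graph ↔ ∀ φ : 𝓓(openInterval a b, ℂ),
      ⟪g, testToL2 a b φ⟫_ℂ = ⟪u, testDerivToL2 a b φ⟫_ℂ := by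
  have hd : Dense ((derivOp a b).domain : Set (L2 a b)) := dense_testToL2
  constructor
  · intro h φ
    obtain ⟨y, hy, hyg⟩ := (LinearPMap.mem_graph_iff _).1 h
    have := LinearPMap.adjoint_isFormalAdjoint hd y ⟨testToL2 a b φ, ⟨φ, rfl⟩⟩
    rw [derivOp_apply, hy] at this
    rw [← this]
    exact congrArg (fun z => ⟪z, testToL2 a b φ⟫_ℂ) hyg.symm
  · intro h
    have h' : ∀ x : (derivOp a b).domain, ⟪g, (x : L2 a b)⟫_ℂ = ⟪u, derivOp a b x⟫_ℂ := by
      rintro ⟨_, φ, rfl⟩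
      rw [derivOp_apply]
      exact h φ
    refine (LinearPMap.mem_graph_iff _).2
      ⟨⟨u, LinearPMap.mem_adjoint_domain_of_exists u ⟨g, h'⟩⟩, rfl, ?_⟩
    exact LinearPMap.adjoint_apply_eq hd _ h'

/-- By parts, `u + V g` is orthogonal to every derivative of a test function, hence constant by du
Bois-Reymond. Conversely, constants are orthogonal to these derivatives. -/
theorem mem_graph_derivAdj_iff_exists (hab : a < b) {u g : L2 a b} :
    (u, g) ∈ (derivAdj a b).graph ↔ ∃ c : ℂ, u = c • oneL2 a b - volterra a b g := by
  rw [mem_graph_derivAdj_iff]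
  constructor
  · intro h
    obtain ⟨c, hc⟩ := eq_smul_one_of_inner_testDeriv_eq_zero hab (w := u + volterra a b g)
      fun φ => by rw [inner_add_left, ← h φ, inner_volterra_testDeriv hab, add_neg_cancel]
    exact ⟨c, eq_sub_of_add_eq hc⟩
  · rintro ⟨c, rfl⟩ φ
    rw [inner_sub_left, inner_smul_left, inner_one_testDeriv hab, inner_volterra_testDeriv hab,
      mul_zero, zero_sub, neg_neg]

theorem mem_graph_weakDeriv_iff {u h : L2 a b} :
    (u, h) ∈ (weakDeriv a b).graph ↔ (u, -h) ∈ (derivAdj a b).graph := by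
  rw [weakDeriv, LinearPMap.neg_graph]
  constructor
  · rintro ⟨⟨u', h'⟩, hm, he⟩
    simp only [Prod.mk.injEq, LinearMap.prodMap_apply, LinearMap.id_apply, LinearMap.neg_apply]
      at he
    rwa [← he.1, ← he.2, neg_neg]
  · exact fun hm => ⟨(u, -h), hm, by simp⟩

theorem mem_graph_weakDeriv_iff_exists (hab : a < b) {u h : L2 a b} :
    (u, h) ∈ (weakDeriv a b).graph ↔ ∃ c : ℂ, u = c • oneL2 a b + volterra a b h := by
  rw [mem_graph_weakDeriv_iff, mem_graph_derivAdj_iff_exists hab]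
  simp only [map_neg, sub_neg_eq_add]

theorem testToL2_mem_graph (hab : a < b) (φ : 𝓓(openInterval a b, ℂ)) :
    (testToL2 a b φ, testDerivToL2 a b φ) ∈ (weakDeriv a b).graph :=
  (mem_graph_weakDeriv_iff_exists hab).2 ⟨0, by rw [volterra_testDeriv, zero_smul, zero_add]⟩

theorem _root_.LinearPMap.mem_graph_domRestrict_iff {E F : Type*} [AddCommGroup E] [Module ℂ E]
    [AddCommGroup F] [Module ℂ F] (T : E →ₗ.[ℂ] F) (S : Submodule ℂ E) {u : E} {h : F} :
    (u, h) ∈ (T.domRestrict S).graph ↔ u ∈ S ∧ (u, h) ∈ T.graph := by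
  constructor
  · intro hm
    exact ⟨(LinearPMap.mem_domain_of_mem_graph hm).1,
      LinearPMap.le_graph_of_le LinearPMap.domRestrict_le hm⟩
  · rintro ⟨hS, hT⟩
    obtain ⟨v, rfl, hv⟩ := (LinearPMap.mem_graph_iff _).1 hT
    refine (LinearPMap.mem_graph_iff _).2 ⟨⟨(v : E), ⟨hS, v.2⟩⟩, rfl, ?_⟩
    exact (LinearPMap.domRestrict_apply rfl).trans hv

theorem volterra_mem_graph_weakDeriv (hab : a < b) (h : L2 a b) :
    (volterra a b h, h) ∈ (weakDeriv a b).graph :=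
  (mem_graph_weakDeriv_iff_exists hab).2 ⟨0, by rw [zero_smul, zero_add]⟩

/-- Both properties hold for test functions and survive limits in the Sobolev norm, since `V` and
the mean are continuous on `L²`. -/
theorem eq_volterra_of_mem_sobolevZero (hab : a < b) {u h : L2 a b} (hu : u ∈ sobolevZero a b)
    (hg : (u, h) ∈ (weakDeriv a b).graph) : u = volterra a b h ∧ ⟪oneL2 a b, h⟫_ℂ = 0 := by
  obtain ⟨v, φ, rfl, hφ, h1, h2⟩ := hu
  have hvh : weakDeriv a b v = h :=
    LinearPMap.mem_graph_snd_inj _ (LinearPMap.mem_graph _ v) hg rfl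
  rw [hvh] at h2
  choose ψ hψ using hφ
  have hd : ∀ n, weakDeriv a b (φ n) = testDerivToL2 a b (ψ n) := fun n =>
    LinearPMap.mem_graph_snd_inj _ (LinearPMap.mem_graph _ (φ n))
      (testToL2_mem_graph hab (ψ n)) (hψ n).symm
  simp only [hd] at h2
  simp only [← hψ] at h1
  constructor
  · have h3 := ((volterra a b).continuous.tendsto h).comp h2
    simp only [Function.comp_def, volterra_testDeriv] at h3
    exact tendsto_nhds_unique h1 h3
  · have h3 := (tendsto_const_nhds (x := oneL2 a b)).inner (𝕜 := ℂ) h2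
    simp only [inner_one_testDeriv hab] at h3
    exact tendsto_nhds_unique h3 tendsto_const_nhds

/-- Approximate `h` by test functions `ψ n` and subtract from each its mean times `ψ₀`. The
differences are derivatives of test functions, and the corrections tend to zero because `h` has mean
zero. -/
theorem exists_tendsto_testDeriv (hab : a < b) {h : L2 a b} (h0 : ⟪oneL2 a b, h⟫_ℂ = 0) :
    ∃ φ : ℕ → 𝓓(openInterval a b, ℂ),
      Tendsto (fun n => testDerivToL2 a b (φ n)) atTop (𝓝 h) := by
  obtain ⟨ψ₀, h₀⟩ := exists_test_mean_one hab
  obtain ⟨x, hx, hxl⟩ := mem_closure_iff_seq_limit.1 (dense_testToL2 (a := a) (b := b) h)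
  choose ψ hψ using hx
  choose φ hφ using fun n => exists_deriv_eq_sub hab h₀ (ψ n)
  refine ⟨φ, ?_⟩
  have h3 := hxl.sub (((tendsto_const_nhds (x := oneL2 a b)).inner (𝕜 := ℂ) hxl).smul_const
    (testToL2 a b ψ₀))
  rw [h0, zero_smul, sub_zero] at h3
  refine h3.congr fun n => ?_
  rw [hφ, hψ]

/-- If `φ n' → h`, then `φ n = V (φ n') → V h` by continuity of `V`, so convergence of the
derivatives alone gives convergence in the Sobolev norm. -/
theorem volterra_mem_sobolevZero (hab : a < b) {h : L2 a b} (h0 : ⟪oneL2 a b, h⟫_ℂ = 0) :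
    volterra a b h ∈ sobolevZero a b := by
  obtain ⟨φ, hlim⟩ := exists_tendsto_testDeriv hab h0
  obtain ⟨v, hv, hvh⟩ := (LinearPMap.mem_graph_iff _).1 (volterra_mem_graph_weakDeriv hab h)
  choose y hy hyd using fun n =>
    (LinearPMap.mem_graph_iff _).1 (testToL2_mem_graph hab (φ n))
  dsimp only at hv hvh hy hyd
  refine ⟨v, y, hv, fun n => ⟨φ n, (hy n).symm⟩, ?_, ?_⟩
  · have h3 := ((volterra a b).continuous.tendsto h).comp hlim
    simp only [Function.comp_def, volterra_testDeriv] at h3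
    simpa only [hy, hv] using h3
  · simpa only [hyd, hvh] using hlim

/-- Elements of `W¹₀` are the primitives from `a` of the functions of mean zero. -/
theorem mem_graph_domRestrict_sobolevZero_iff (hab : a < b) {u h : L2 a b} :
    (u, h) ∈ ((weakDeriv a b).domRestrict (sobolevZero a b)).graph ↔
      u = volterra a b h ∧ ⟪oneL2 a b, h⟫_ℂ = 0 := by
  rw [LinearPMap.mem_graph_domRestrict_iff]
  constructor
  · exact fun h => eq_volterra_of_mem_sobolevZero hab h.1 h.2
  · rintro ⟨rfl, h0⟩
    exact ⟨volterra_mem_sobolevZero hab h0, volterra_mem_graph_weakDeriv hab h⟩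

end Sobolev

/-! ### The diffusion operator and its inverse -/

/-- The natural domain is exactly what makes the graph of a composition the relational composition
of the graphs. -/
theorem mem_graph_pcomp_iff {E : Type*} [AddCommGroup E] [Module ℂ E] {S T : E →ₗ.[ℂ] E}
    {u w : E} : (u, w) ∈ (pcomp S T).graph ↔ ∃ v, (u, v) ∈ T.graph ∧ (v, w) ∈ S.graph := by
  constructor
  · intro h
    obtain ⟨⟨u', hu'⟩, rfl, hw⟩ := (LinearPMap.mem_graph_iff _).1 h
    obtain ⟨v, hv, rfl⟩ := hu'
    exact ⟨T v, LinearPMap.mem_graph _ v,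
      (LinearPMap.mem_graph_iff _).2 ⟨⟨T v, hv⟩, rfl, hw⟩⟩
  · rintro ⟨v, hT, hS⟩
    obtain ⟨u', rfl, rfl⟩ := (LinearPMap.mem_graph_iff _).1 hT
    obtain ⟨⟨v', hv'⟩, hv, hw⟩ := (LinearPMap.mem_graph_iff _).1 hS
    dsimp only at hv hw
    subst hv
    exact (LinearPMap.mem_graph_iff _).2 ⟨⟨(u' : E), ⟨u', hv', rfl⟩⟩, rfl, hw⟩

section Diffusion

variable {a b : ℝ}

theorem mem_graph_mulOp_iff {m : ℝ → ℝ} {v w : L2 a b} :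
    (v, w) ∈ (mulOp a b m).graph ↔ ∀ᵐ x ∂intervalMeasure a b, w x = (m x : ℂ) * v x := by
  constructor
  · intro h
    obtain ⟨v', rfl, rfl⟩ := (LinearPMap.mem_graph_iff _).1 h
    exact MemLp.coeFn_toLp v'.2
  · intro h
    have hv : MemLp (fun x => (m x : ℂ) * v x) 2 (intervalMeasure a b) := (Lp.memLp w).ae_eq h
    refine (LinearPMap.mem_graph_iff _).2 ⟨⟨v, hv⟩, rfl, Lp.ext ?_⟩
    filter_upwards [MemLp.coeFn_toLp hv, h] with x h1 h2
    exact h1.trans h2.symm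

/-- Here `h` is `∂u` and `w` is `p ∂u`; each of the three factors of the operator contributes one
condition. -/
theorem mem_graph_diffusionOp_iff (hab : a < b) {p : LInf a b} {u f : L2 a b} :
    (u, f) ∈ (diffusionOp a b p).graph ↔ ∃ h w : L2 a b,
      (u = volterra a b h ∧ ⟪oneL2 a b, h⟫_ℂ = 0) ∧
      (∀ᵐ x ∂intervalMeasure a b, w x = (((p x)⁻¹ : ℝ) : ℂ) * h x) ∧
      ∃ c : ℂ, w = c • oneL2 a b - volterra a b f := by
  rw [diffusionOp, mem_graph_pcomp_iff]
  constructor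
  · rintro ⟨w, hw, hf⟩
    obtain ⟨h, hu, hm⟩ := mem_graph_pcomp_iff.1 hw
    exact ⟨h, w, (mem_graph_domRestrict_sobolevZero_iff hab).1 hu, mem_graph_mulOp_iff.1 hm,
      (mem_graph_derivAdj_iff_exists hab).1 hf⟩
  · rintro ⟨h, w, hu, hm, hf⟩
    exact ⟨w, mem_graph_pcomp_iff.2 ⟨h, (mem_graph_domRestrict_sobolevZero_iff hab).2 hu,
      mem_graph_mulOp_iff.2 hm⟩, (mem_graph_derivAdj_iff_exists hab).2 hf⟩

theorem regular_pos {p : LInf a b} (hp : p ∈ regularClass a b) :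
    ∀ᵐ x ∂intervalMeasure a b, 0 < p x := by
  obtain ⟨C₁, C₂, h1, -, h2⟩ := hp
  filter_upwards [h2] with x hx using h1.trans_le hx.1

theorem regular_ne_zero (hab : a < b) {p : LInf a b} (hp : p ∈ regularClass a b) : p ≠ 0 := by
  rintro rfl
  have hne : (ae (intervalMeasure a b)).NeBot := by
    rw [ae_neBot, Ne, Measure.restrict_eq_zero, Real.volume_Ioo, ENNReal.ofReal_eq_zero]
    linarith
  obtain ⟨x, h1, h2⟩ := ((regular_pos hp).and
    (Lp.coeFn_zero ℝ ∞ (intervalMeasure a b))).exists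
  rw [h2] at h1
  exact lt_irrefl _ h1

theorem regular_subset_asymptotic (hab : a < b) : regularClass a b ⊆ asymptoticClass a b :=
  fun _ hp => ⟨(regular_pos hp).mono fun _ => le_of_lt, regular_ne_zero hab hp⟩

theorem prim_coeff_eq_norm1 (hab : a < b) {p : LInf a b}
    (hp : ∀ᵐ x ∂intervalMeasure a b, 0 ≤ p x) :
    prim a (fun t => (p t : ℂ)) b = norm1 a b p := by
  rw [prim, intervalIntegral.integral_ofReal, norm1, intervalIntegral_eq hab.le,
    intervalIntegral_eq hab.le]
  congr 1
  refine integral_congr_ae ?_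
  filter_upwards [hp] with x hx using (abs_of_nonneg hx).symm

theorem prim_mul_const_sub (p : LInf a b) (f : L2 a b) (c : ℂ) {x : ℝ} (hx : x ∈ Icc a b) :
    prim a (fun t => (p t : ℂ) * (-prim a f t + c)) x =
      -prim a (fun t => (p t : ℂ) * prim a f t) x + c * prim a (fun t => (p t : ℂ)) x := by
  have h1 := integrable_mul_prim (integrable_coeff p) (integrable_L2 f)
  have h2 := prim_add (h1.const_mul (-1)) ((integrable_coeff p).const_mul c) hx
  rw [prim_const_mul, prim_const_mul, neg_one_mul] at h2
  rw [← h2]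
  congr 1
  ext t
  ring

theorem norm1_mul_fluxConst (hab : a < b) {p : LInf a b} (hp : p ≠ 0) (f : L2 a b) :
    (norm1 a b p : ℂ) * fluxConst p f = prim a (fun t => (p t : ℂ) * prim a f t) b := by
  have hn : (norm1 a b p : ℂ) ≠ 0 := by exact_mod_cast (norm1_pos hab hp).ne'
  rw [fluxConst_apply, mul_inv_cancel_left₀ hn, prim, intervalIntegral_eq hab.le]

/-- Positivity of the coefficient allows `h / p = c - V f` to be solved for `h`; the mean-zero
condition then determines `c`, and `u = V h` follows. -/
theorem eq_solOp_of_mem_graph (hab : a < b) {p : LInf a b} (hp : p ∈ regularClass a b)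
    {u f : L2 a b} (hm : (u, f) ∈ (diffusionOp a b p).graph) : u = solOp p f := by
  obtain ⟨h, w, ⟨rfl, h0⟩, hw, c, hc⟩ := (mem_graph_diffusionOp_iff hab).1 hm
  have hp0 := (regular_subset_asymptotic hab hp).1
  have hne := regular_ne_zero hab hp
  have hh : h =ᵐ[intervalMeasure a b] fun t => (p t : ℂ) * (-prim a f t + c) := by
    filter_upwards [hw, regular_pos hp, volterra_coeFn f, oneL2_coeFn (a := a) (b := b),
      Lp.coeFn_sub (c • oneL2 a b) (volterra a b f), Lp.coeFn_smul c (oneL2 a b)]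
      with x h1 h2 h3 h4 h5 h6
    rw [hc, h5, Pi.sub_apply, h6, Pi.smul_apply, h4, h3, smul_eq_mul, mul_one] at h1
    have h7 : (p x : ℂ) ≠ 0 := by exact_mod_cast h2.ne'
    rw [neg_add_eq_sub, h1, Complex.ofReal_inv, mul_inv_cancel_left₀ h7]
  -- Since `∫ p = ‖p‖₁`, the mean of `h` is `‖p‖₁ (c - fluxConst p f)`, and `‖p‖₁ ≠ 0`.
  have hcF : c = fluxConst p f := by
    rw [inner_oneL2 hab, prim_congr hh ⟨hab.le, le_rfl⟩,
      prim_mul_const_sub p f c ⟨hab.le, le_rfl⟩, prim_coeff_eq_norm1 hab hp0,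
      ← norm1_mul_fluxConst hab hne, mul_comm c, neg_add_eq_sub, ← mul_sub] at h0
    have hn : (norm1 a b p : ℂ) ≠ 0 := by exact_mod_cast (norm1_pos hab hne).ne'
    exact sub_eq_zero.1 ((mul_eq_zero.1 h0).resolve_left hn)
  refine Lp.ext ?_
  filter_upwards [volterra_coeFn h, solOp_coeFn p f, ae_mem_Icc a b] with x h1 h2 hx
  rw [h1, h2, prim_congr hh hx, prim_mul_const_sub p f c hx, hcF]

/-- Boundedness of the coefficient keeps `p · C f` in `L²`, as required of a weak derivative. -/
theorem memLp_coeff_mul (p : LInf a b) (v : L2 a b) :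
    MemLp (fun x => (p x : ℂ) * v x) 2 (intervalMeasure a b) :=
  (Lp.memLp v).mul (p := ∞) (q := 2) (Lp.memLp p).ofReal

/-- The element `p · C f` of `L²`, the derivative of `B f`. -/
def solDeriv (p : LInf a b) (f : L2 a b) : L2 a b := (memLp_coeff_mul p (flxOp p f)).toLp

theorem solDeriv_coeFn (p : LInf a b) (f : L2 a b) :
    ∀ᵐ x ∂intervalMeasure a b, solDeriv p f x = (p x : ℂ) * flxOp p f x :=
  MemLp.coeFn_toLp (memLp_coeff_mul p (flxOp p f))

theorem solDeriv_coeFn' (p : LInf a b) (f : L2 a b) :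
    solDeriv p f =ᵐ[intervalMeasure a b]
      fun t => (p t : ℂ) * (-prim a f t + fluxConst p f) := by
  filter_upwards [solDeriv_coeFn p f, flxOp_coeFn p f] with x h1 h2
  rw [h1, h2]

theorem solOp_eq_volterra (p : LInf a b) (f : L2 a b) :
    solOp p f = volterra a b (solDeriv p f) := by
  refine Lp.ext ?_
  filter_upwards [solOp_coeFn p f, volterra_coeFn (solDeriv p f), ae_mem_Icc a b] with x h1 h2 hx
  rw [h1, h2, prim_congr (solDeriv_coeFn' p f) hx, prim_mul_const_sub p f _ hx]

theorem inner_one_solDeriv (hab : a < b) {p : LInf a b} (hp : p ∈ asymptoticClass a b)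
    (f : L2 a b) : ⟪oneL2 a b, solDeriv p f⟫_ℂ = 0 := by
  rw [inner_oneL2 hab, prim_congr (solDeriv_coeFn' p f) ⟨hab.le, le_rfl⟩,
    prim_mul_const_sub p f _ ⟨hab.le, le_rfl⟩, prim_coeff_eq_norm1 hab hp.1,
    ← norm1_mul_fluxConst hab hp.2, mul_comm, neg_add_cancel]

theorem flxOp_eq_inv_mul {p : LInf a b} (hp : p ∈ regularClass a b) (f : L2 a b) :
    ∀ᵐ x ∂intervalMeasure a b, flxOp p f x = (((p x)⁻¹ : ℝ) : ℂ) * solDeriv p f x := by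
  filter_upwards [solDeriv_coeFn p f, regular_pos hp] with x h1 h2
  have h3 : (p x : ℂ) ≠ 0 := by exact_mod_cast h2.ne'
  rw [h1, Complex.ofReal_inv, inv_mul_cancel_left₀ h3]

theorem flxOp_apply (p : LInf a b) (f : L2 a b) :
    flxOp p f = fluxConst p f • oneL2 a b - volterra a b f :=
  neg_add_eq_sub _ _

/-- The witnesses are the derivative `p · C f`, the flux `C f` and the constant `fluxConst p f`. -/
theorem solOp_mem_graph (hab : a < b) {p : LInf a b} (hp : p ∈ regularClass a b) (f : L2 a b) :
    (solOp p f, f) ∈ (diffusionOp a b p).graph :=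
  (mem_graph_diffusionOp_iff hab).2 ⟨solDeriv p f, flxOp p f, ⟨solOp_eq_volterra p f,
    inner_one_solDeriv hab (regular_subset_asymptotic hab hp) f⟩, flxOp_eq_inv_mul hp f,
    fluxConst p f, flxOp_apply p f⟩

theorem diffusionOp_bijective (hab : a < b) {p : LInf a b} (hp : p ∈ regularClass a b) :
    Function.Bijective (diffusionOp a b p) := by
  constructor
  · intro u v huv
    have h1 := eq_solOp_of_mem_graph hab hp (LinearPMap.mem_graph _ u)
    have h2 := eq_solOp_of_mem_graph hab hp (LinearPMap.mem_graph _ v)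
    exact Subtype.ext (h1.trans ((congrArg _ huv).trans h2.symm))
  · intro f
    obtain ⟨u, -, hu⟩ := (LinearPMap.mem_graph_iff _).1 (solOp_mem_graph hab hp f)
    exact ⟨u, hu⟩

theorem mem_graph_toPMap_top (R : L2 a b →L[ℂ] L2 a b) (f : L2 a b) :
    (f, R f) ∈ ((R : L2 a b →ₗ[ℂ] L2 a b).toPMap ⊤).graph :=
  (LinearPMap.mem_graph_iff _).2 ⟨⟨f, trivial⟩, rfl, rfl⟩

/-- An operator defined everywhere has no proper single-valued extension, so it is enough that `T`
extends `R`. -/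
theorem eqBounded_of_mem_graph {T : L2 a b →ₗ.[ℂ] L2 a b} {R : L2 a b →L[ℂ] L2 a b}
    (h : ∀ f, (f, R f) ∈ T.graph) : EqBounded T R := by
  refine LinearPMap.eq_of_eq_graph (le_antisymm ?_ ?_)
  · rintro ⟨f, g⟩ hfg
    rw [LinearPMap.mem_graph_snd_inj T hfg (h f) rfl]
    exact mem_graph_toPMap_top R f
  · rintro ⟨f, g⟩ hfg
    obtain ⟨f', hf, hg⟩ := (LinearPMap.mem_graph_iff _).1 hfg
    dsimp only at hf hg
    rw [← hg, ← hf]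
    exact h f'

theorem EqBounded.unique {T : L2 a b →ₗ.[ℂ] L2 a b} {R S : L2 a b →L[ℂ] L2 a b}
    (hR : EqBounded T R) (hS : EqBounded T S) : R = S := by
  ext1 f
  have hR' : (f, R f) ∈ T.graph := by
    rw [hR]
    exact mem_graph_toPMap_top R f
  have hS' : (f, S f) ∈ T.graph := by
    rw [hS]
    exact mem_graph_toPMap_top S f
  exact LinearPMap.mem_graph_snd_inj T hR' hS' rfl

theorem mem_graph_solutionOp (hab : a < b) {p : LInf a b} (hp : p ∈ regularClass a b)
    (f : L2 a b) : (f, solOp p f) ∈ (solutionOp a b p).graph := by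
  have hker : (diffusionOp a b p).toFun.ker = ⊥ :=
    LinearMap.ker_eq_bot.2 (diffusionOp_bijective hab hp).1
  rw [solutionOp, LinearPMap.inverse_graph hker]
  exact ⟨(solOp p f, f), solOp_mem_graph hab hp f, rfl⟩

/-- With `u = A⁻¹ f` one has `D_I^* u = -∂u = -p · C f` in terms of the coefficient `p`; division by
`p` leaves `-C f`, and the outer sign removes the minus. -/
theorem mem_graph_fluxOp (hab : a < b) {p : LInf a b} (hp : p ∈ regularClass a b)
    (f : L2 a b) : (f, flxOp p f) ∈ (fluxOp a b p).graph := by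
  rw [fluxOp, LinearPMap.neg_graph]
  refine ⟨(f, -flxOp p f), mem_graph_pcomp_iff.2 ⟨-solDeriv p f, mem_graph_pcomp_iff.2
    ⟨solOp p f, mem_graph_solutionOp hab hp f, ?_⟩, mem_graph_mulOp_iff.2 ?_⟩, by simp⟩
  · rw [solOp_eq_volterra]
    exact mem_graph_weakDeriv_iff.1 (volterra_mem_graph_weakDeriv hab _)
  · filter_upwards [flxOp_eq_inv_mul hp f, Lp.coeFn_neg (flxOp p f), Lp.coeFn_neg (solDeriv p f)]
      with x h1 h2 h3
    rw [h2, h3, Pi.neg_apply, Pi.neg_apply, h1, mul_neg]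

/-! ### Uniqueness of the extensions -/

/-- Adding a positive constant to an element of the asymptotic class gives an element of `𝓛`. -/
theorem add_const_mem_regularClass {p : LInf a b} (hp : p ∈ asymptoticClass a b)
    {ε : ℝ} (hε : 0 < ε) : p + Lp.const ∞ (intervalMeasure a b) ε ∈ regularClass a b := by
  -- The lower bound uses `p ≥ 0`; the upper one uses that the `L^∞` norm is an essential bound.
  refine ⟨ε, ‖p‖ + ε, hε, le_add_of_nonneg_left (norm_nonneg _), ?_⟩
  have hle : ∀ᵐ x ∂intervalMeasure a b, ‖p x‖ ≤ ‖p‖ := by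
    filter_upwards [ae_le_eLpNormEssSup (f := p) (μ := intervalMeasure a b)] with x hx
    rw [← eLpNorm_exponent_top, ← Lp.enorm_def] at hx
    exact enorm_le_iff_norm_le.1 hx
  filter_upwards [hp.1, hle, Lp.coeFn_add p (Lp.const ∞ (intervalMeasure a b) ε),
    Lp.coeFn_const ∞ (intervalMeasure a b) ε] with x h1 h2 h3 h4
  rw [h3, Pi.add_apply, h4, Function.const_apply]
  exact ⟨le_add_of_nonneg_left h1, by linarith [le_abs_self (p x), Real.norm_eq_abs (p x)]⟩

theorem norm1_const (hab : a < b) {ε : ℝ} (hε : 0 ≤ ε) :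
    norm1 a b (Lp.const ∞ (intervalMeasure a b) ε) = (b - a) * ε := by
  rw [norm1, intervalIntegral_eq hab.le]
  refine (integral_congr_ae (g := fun _ => ε) ?_).trans ?_
  · filter_upwards [Lp.coeFn_const ∞ (intervalMeasure a b) ε] with x hx
    rw [hx, Function.const_apply, abs_of_nonneg hε]
  · rw [← intervalIntegral_eq hab.le, intervalIntegral.integral_const, smul_eq_mul]

/-- The sequence `p + 1/(n+1)` has `L¹` distance `(b - a)/(n+1)` from `p`, so `𝓛` is sequentially
dense in `𝓟`. -/
theorem exists_regular_approx (hab : a < b) (p : asymptoticClass a b) :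
    ∃ q : ℕ → asymptoticClass a b, (∀ n, (q n : LInf a b) ∈ regularClass a b) ∧
      Tendsto (fun n => norm1 a b ((q n : LInf a b) - p)) atTop (𝓝 0) := by
  have hmem : ∀ n : ℕ, (p : LInf a b) + Lp.const ∞ (intervalMeasure a b) (1 / ((n : ℝ) + 1)) ∈
      regularClass a b := fun n => add_const_mem_regularClass p.2 (by positivity)
  refine ⟨fun n => ⟨_, regular_subset_asymptotic hab (hmem n)⟩, hmem, ?_⟩
  have h := (tendsto_one_div_add_atTop_nhds_zero_nat (𝕜 := ℝ)).const_mul (b - a)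
  rw [mul_zero] at h
  refine h.congr fun n => ?_
  rw [add_sub_cancel_left, norm1_const hab (by positivity)]

theorem IsSeqContExtension.unique (hab : a < b) {T : LInf a b → (L2 a b →ₗ.[ℂ] L2 a b)}
    {Φ Ψ : asymptoticClass a b → (L2 a b →L[ℂ] L2 a b)} (hΦ : IsSeqContExtension T Φ)
    (hΨ : IsSeqContExtension T Ψ) : Φ = Ψ := by
  funext p
  obtain ⟨q, hq, hlim⟩ := exists_regular_approx hab p
  have h : ∀ n, Φ (q n) = Ψ (q n) := fun n => (hΦ.1 _ (hq n)).unique (hΨ.1 _ (hq n))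
  exact tendsto_nhds_unique (hΦ.2 q p hlim) ((hΨ.2 q p hlim).congr fun n => (h n).symm)

theorem isSeqContExtension_solOp (hab : a < b) :
    IsSeqContExtension (solutionOp a b) fun p => solOp (p : LInf a b) :=
  ⟨fun _ hp => eqBounded_of_mem_graph (mem_graph_solutionOp hab hp),
    fun _ p h => tendsto_solOp hab p.2.2 h⟩

theorem isSeqContExtension_flxOp (hab : a < b) :
    IsSeqContExtension (fluxOp a b) fun p => flxOp (p : LInf a b) :=
  ⟨fun _ hp => eqBounded_of_mem_graph (mem_graph_fluxOp hab hp),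
    fun _ p h => tendsto_flxOp hab p.2.2 h⟩

end Diffusion

end

end Diffusion1D

/-! ### Convergence and unique extension of the solution and flux operators -/

theorem mainTheorem6 (a b : ℝ) (hab : a < b) :
    ∃ B C : asymptoticClass a b → (L2 a b →L[ℂ] L2 a b),
      (∀ (p : asymptoticClass a b) (f : L2 a b),
        (∀ᵐ x ∂intervalMeasure a b, B p f x = limitSolution a b p f x) ∧
        (∀ᵐ x ∂intervalMeasure a b, C p f x = limitFlux a b p f x)) ∧
      (∀ (pbar : ℕ → LInf a b) (pinf : asymptoticClass a b),
        (∀ ν, pbar ν ∈ regularClass a b) →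
        Tendsto (fun ν => norm1 a b (pbar ν - pinf)) atTop (𝓝 0) →
        (∀ ν, Function.Bijective (diffusionOp a b (pbar ν))) ∧
        ∃ R S : ℕ → (L2 a b →L[ℂ] L2 a b),
          (∀ ν, EqBounded (solutionOp a b (pbar ν)) (R ν)) ∧
          (∀ ν, EqBounded (fluxOp a b (pbar ν)) (S ν)) ∧
          Tendsto R atTop (𝓝 (B pinf)) ∧ Tendsto S atTop (𝓝 (C pinf))) ∧
      (IsSeqContExtension (solutionOp a b) B ∧
        ∀ Φ, IsSeqContExtension (solutionOp a b) Φ → Φ = B) ∧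
      (IsSeqContExtension (fluxOp a b) C ∧
        ∀ Φ, IsSeqContExtension (fluxOp a b) Φ → Φ = C) := by
  refine ⟨fun p => solOp (p : LInf a b), fun p => flxOp (p : LInf a b),
    fun p f => ⟨solOp_eq_limitSolution hab p f, flxOp_eq_limitFlux hab p f⟩,
    fun q p hq h => ⟨fun ν => diffusionOp_bijective hab (hq ν), fun ν => solOp (q ν),
      fun ν => flxOp (q ν), fun ν => eqBounded_of_mem_graph (mem_graph_solutionOp hab (hq ν)),
      fun ν => eqBounded_of_mem_graph (mem_graph_fluxOp hab (hq ν)),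
      tendsto_solOp hab p.2.2 h, tendsto_flxOp hab p.2.2 h⟩,
    ⟨isSeqContExtension_solOp hab, fun _ hΦ => hΦ.unique hab (isSeqContExtension_solOp hab)⟩,
    isSeqContExtension_flxOp hab, fun _ hΦ => hΦ.unique hab (isSeqContExtension_flxOp hab)⟩
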